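/- Let $\lambda>1$ and $\boldsymbol\mu=(\mu_0,\mu_1,\mu_2)$ with $\mu_0=1$ and $\mu_1,\mu_2>0$. Put $2\lambda_j=2\lambda-2+2j$ and $$d_\ell=\sum_{j=0}^{\ell}\binom{\ell}{j}^2\frac{(\ell-j)!}{(2\lambda_j)_{\ell-j}}\,\mu_j^2\qquad(0\le\ell\le 2),$$ where $(x)_k=x(x+1)\cdots(x+k-1)$. Let $\mathrm B=\mathrm{diag}(d_0,d_1,d_2)$, $D(x)=\mathrm{diag}((1-x)^2,1-x,1)$, and let $\mathbb S$ be the $3\times3$ matrix with entries $\mathbb S_{1,0}=1$, $\mathbb S_{2,1}=2$ and all others $0$ (indices $0,1,2$). Let $\mathbf A^{(\lambda,\boldsymbol\mu)}(\mathbb D)$ be the Hilbert space of $\mathbb C^3$-valued functions on the open unit disc $\mathbb D$ with reproducing kernel $$K^{(\lambda,\boldsymbol\mu)}(z,w)=(1-z\bar w)^{-2\lambda-2}\,D(z\bar w)\exp(\bar w\,\mathbb S)\,\mathrm B\,\exp(z\,\mathbb S^*)\,D(z\bar w),$$ and let $M^{(\lambda,\boldsymbol\mu)}$ be the operator of multiplication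 by $z$ on it. Let $$\tilde K(z,w)=K(0,0)^{1/2}K(z,0)^{-1}K(z,w)K(0,w)^{-1}K(0,0)^{1/2}$$ be the normalized kernel of $K=K^{(\lambda,\boldsymbol\mu)}$, and $h_{\lambda,\boldsymbol\mu}(z)=\tilde K(z,z)^{t}$. Let $$\mathcal K_{\lambda,\boldsymbol\mu}=\bar\partial\big(h_{\lambda,\boldsymbol\mu}^{-1}\,\partial h_{\lambda,\boldsymbol\mu}\big),\qquad (\mathcal K_{\lambda,\boldsymbol\mu})_{\bar z}=\bar\partial\,\mathcal K_{\lambda,\boldsymbol\mu}$$ be the curvature and its covariant derivative of order $(0,1)$. **Theorem.** Let $(\lambda,\boldsymbol\mu)$ and $(\lambda',\boldsymbol\nu)$ be two such sets of parameters. Suppose that $M^{(\lambda,\boldsymbol\mu)}$ and $M^{(\lambda',\boldsymbol\nu)}$ are not unitarily equivalent, and that for every $z\in\mathbb D$ the curvatures $\mathcal K_{\lambda,\boldsymbol\mu}(z)$ and $\mathcal K_{\lambda',\boldsymbol\nu}(z)$ are unitarily equivalent, that is, intertwined by a unitary map from $(\mathbb C^3,h_{\lambda,\boldsymbol\mu}(z))$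 onto $(\mathbb C^3,h_{\lambda',\boldsymbol\nu}(z))$. Then there is no invertible matrix $L\in\mathcal M(3,\mathbb C)$ such that both $$L\,\mathcal K_{\lambda,\boldsymbol\mu}(0)=\mathcal K_{\lambda',\boldsymbol\nu}(0)\,L\qquad\text{and}\qquad L\,(\mathcal K_{\lambda,\boldsymbol\mu})_{\bar z}(0)=(\mathcal K_{\lambda',\boldsymbol\nu})_{\bar z}(0)\,L .$$ In other words, the covariant derivative of order $(0,1)$ detects the inequivalence. -/

import Mathlib

open scoped ComplexConjugate Matrix MatrixOrder ComplexOrder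

noncomputable section

namespace KM

/-- The parameters `(λ, μ)` in rank `m + 1`: a real `λ` with `2 λ - m > 0` and a vector
`μ = (μ₀, …, μₘ)` of positive reals with `μ₀ = 1`. -/
structure Param (m : ℕ) where
  lam : ℝ
  mu : Fin (m + 1) → ℝ
  lt_two_mul_lam : (m : ℝ) < 2 * lam
  mu_zero : mu 0 = 1
  mu_pos : ∀ l, 0 < mu l

/-- `2 λⱼ = 2 λ - m + 2 j`. -/
def twoLam {m : ℕ} (p : Param m) (j : ℕ) : ℝ := 2 * p.lam - m + 2 * j

/-- The lower triangular matrix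
`L(λ)_{ℓ j} = binom(ℓ, j)² (ℓ - j)! / (2 λⱼ)_{ℓ - j}` for `j ≤ ℓ`, where `(x)_k` is the rising
factorial. -/
def coeffL {m : ℕ} (p : Param m) : Matrix (Fin (m + 1)) (Fin (m + 1)) ℝ :=
  Matrix.of fun l j =>
    if j ≤ l then
      ((l : ℕ).choose j : ℝ) ^ 2 * (((l : ℕ) - (j : ℕ)).factorial : ℝ) /
        (ascPochhammer ℝ ((l : ℕ) - (j : ℕ))).eval (twoLam p j)
    else 0

/-- The vector `d = L(λ) (μ₀², …, μₘ²)ᵗ`. -/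
def vecD {m : ℕ} (p : Param m) : Fin (m + 1) → ℝ :=
  coeffL p *ᵥ fun j => p.mu j ^ 2

/-- The diagonal matrix `B = diag (d₀, …, dₘ)`. -/
def matB {m : ℕ} (p : Param m) : Matrix (Fin (m + 1)) (Fin (m + 1)) ℂ :=
  Matrix.diagonal fun l => (vecD p l : ℂ)

/-- The forward shift with weights `1, …, m`: its `(ℓ, k)` entry is `ℓ` if `ℓ = k + 1`, and `0`
otherwise. -/
def shift (m : ℕ) : Matrix (Fin (m + 1)) (Fin (m + 1)) ℂ :=
  Matrix.of fun l k => if (l : ℕ) = (k : ℕ) + 1 then ((l : ℕ) : ℂ) else 0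

/-- The diagonal matrix `D(x) = diag ((1 - x) ^ (m - ℓ))`. -/
def matD (m : ℕ) (x : ℂ) : Matrix (Fin (m + 1)) (Fin (m + 1)) ℂ :=
  Matrix.diagonal fun l => (1 - x) ^ (m - (l : ℕ))

/-- The matrix valued kernel
`K(z, w) = (1 - z w̄) ^ (-2 λ - m) D(z w̄) exp(w̄ S) B exp(z S*) D(z w̄)`, with the principal branch
of the power. -/
def kernel {m : ℕ} (p : Param m) (z w : ℂ) : Matrix (Fin (m + 1)) (Fin (m + 1)) ℂ :=
  (1 - z * conj w) ^ (-2 * (p.lam : ℂ) - m) •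
    (matD m (z * conj w) * NormedSpace.exp (conj w • shift m) * matB p *
      NormedSpace.exp (z • (shift m)ᴴ) * matD m (z * conj w))

/-- The kernel on the unit disc, with its values regarded as operators on the Hilbert space
`ℂ ^ (m + 1)`. -/
def kernelCLM {m : ℕ} (p : Param m) :
    Matrix Complex.UnitDisc Complex.UnitDisc
      (EuclideanSpace ℂ (Fin (m + 1)) →L[ℂ] EuclideanSpace ℂ (Fin (m + 1))) :=
  Matrix.of fun z w => Matrix.toEuclideanCLM (𝕜 := ℂ) (kernel p z w)

theorem hasSum_of_eq {f g : ℕ → ℂ} {a b : ℂ} (h : HasSum f a) (hf : ∀ n, g n = f n) (ha : b = a) :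
    HasSum g b := by
  rwa [ha, funext hf]

/-! The kernel in rank `3` is positive semidefinite. -/

theorem posSemidef_of_hasSum {n : ℕ} (K : ℂ → ℂ → Matrix (Fin n) (Fin n) ℂ) {r : ℕ}
    (A : Fin r → ℕ → ℂ → Fin n → ℂ)
    (hK : ∀ x y : Complex.UnitDisc, ∀ l k, HasSum
      (fun i => ∑ j, A j i x l * conj (A j i y k)) (K x y l k)) :
    Matrix.PosSemidef (Matrix.of fun z w : Complex.UnitDisc =>
      Matrix.toEuclideanCLM (𝕜 := ℂ) (K z w)) := by
  have hH : ∀ x y : Complex.UnitDisc, (K x y)ᴴ = K y x := by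
    intro x y
    ext l k
    have h1 := (hK x y k l).star
    refine h1.unique ?_
    convert hK y x l k using 2 with i
    simp [mul_comm]
  refine ((RKHS.posSemidef_tfae (K := Matrix.of fun z w : Complex.UnitDisc =>
      Matrix.toEuclideanCLM (𝕜 := ℂ) (K z w))).out 0 2).mpr (And.intro ?_ ?_)
  · ext1 x y
    simp [Matrix.conjTranspose_apply, ← map_star, Matrix.star_eq_conjTranspose, hH]
  · intro vv
    have key : ∀ x x' : Complex.UnitDisc, ∀ w w' : EuclideanSpace ℂ (Fin n),
        HasSum (fun i => ∑ j, conj (∑ k, conj (A j i x k) * w k) * ∑ l, conj (A j i x' l) * w' l)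
          (inner ℂ (Matrix.toEuclideanCLM (𝕜 := ℂ) (K x' x) w) w') := by
      intro x x' w w'
      have h1 : HasSum (fun i => ∑ l, ∑ k, conj (∑ j, A j i x' l * conj (A j i x k)) *
          (conj (w k) * w' l)) (∑ l, ∑ k, conj (K x' x l k) * (conj (w k) * w' l)) :=
        hasSum_sum fun l _ => hasSum_sum fun k _ => ((hK x' x l k).star).mul_right _
      convert h1 using 1
      · ext i
        simp only [map_sum, map_mul, Complex.conj_conj, Finset.sum_mul, Finset.mul_sum]
        rw [Finset.sum_comm]
        refine Finset.sum_congr rfl fun l _ => ?_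
        rw [Finset.sum_comm]
        refine Finset.sum_congr rfl fun k _ => ?_
        refine Finset.sum_congr rfl fun j _ => ?_
        ring
      · simp only [PiLp.inner_apply, Matrix.ofLp_toEuclideanCLM, Matrix.mulVec, dotProduct,
          RCLike.inner_apply, map_sum, map_mul, Finset.mul_sum]
        refine Finset.sum_congr rfl fun l _ => Finset.sum_congr rfl fun k _ => ?_
        ring
    have hS : HasSum (fun i => ∑ j, conj (∑ x ∈ vv.support, ∑ k, conj (A j i x k) * vv x k) *
          (∑ x ∈ vv.support, ∑ k, conj (A j i x k) * vv x k))
        (vv.sum fun x w ↦ vv.sum fun x' w' ↦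
          inner ℂ (Matrix.toEuclideanCLM (𝕜 := ℂ) (K x' x) w) w') := by
      have h2 : HasSum _ (∑ x ∈ vv.support, ∑ x' ∈ vv.support,
          inner ℂ (Matrix.toEuclideanCLM (𝕜 := ℂ) (K x' x) (vv x)) (vv x')) :=
        hasSum_sum fun x _ => hasSum_sum fun x' _ => key x x' (vv x) (vv x')
      refine hasSum_of_eq h2 (fun i => ?_) (by simp only [Finsupp.sum])
      simp only [map_sum (starRingEnd ℂ) _ vv.support, Finset.sum_mul_sum]
      rw [Finset.sum_comm]
      refine Finset.sum_congr rfl fun x _ => ?_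
      rw [Finset.sum_comm]
    have hre := Complex.hasSum_re hS
    refine hre.nonneg fun i => ?_
    rw [Complex.re_sum]
    refine Finset.sum_nonneg fun j _ => ?_
    rw [mul_comm, Complex.mul_conj]
    exact_mod_cast Complex.normSq_nonneg _

/-- The Taylor coefficients `(s)ₙ / n!` of `(1 - x) ^ (-s)`. -/
def binCoeff (s : ℝ) (n : ℕ) : ℝ := (ascPochhammer ℝ n).eval s / n.factorial

theorem binCoeff_nonneg {s : ℝ} (hs : 0 < s) (n : ℕ) : 0 ≤ binCoeff s n :=
  div_nonneg (ascPochhammer_pos n s hs).le (by positivity)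

theorem hasSum_binCoeff (s : ℝ) {x : ℂ} (hx : ‖x‖ < 1) :
    HasSum (fun n => (binCoeff s n : ℂ) * x ^ n) ((1 - x) ^ (-(s : ℂ))) := by
  have h := (Complex.one_div_one_sub_cpow_hasFPowerSeriesOnBall_zero (s : ℂ)).hasSum
    (y := x) (by simpa [← ENNReal.ofReal_one, Metric.eball_ofReal] using hx)
  simp only [zero_add, one_div, ← Complex.cpow_neg] at h
  refine hasSum_of_eq h (fun n => ?_) rfl
  rw [FormalMultilinearSeries.ofScalars_apply_eq, smul_eq_mul]
  congr 1
  have h2 := Ring.factorial_nsmul_multichoose_eq_ascPochhammer (s : ℂ) n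
  rw [Polynomial.ascPochhammer_smeval_eq_eval, Ring.multichoose_eq, nsmul_eq_mul] at h2
  have h3 : (((ascPochhammer ℝ n).eval s : ℝ) : ℂ) = (ascPochhammer ℂ n).eval (s : ℂ) := by
    rw [← ascPochhammer_map Complex.ofRealHom n, Polynomial.eval_map, ← Complex.ofRealHom_eq_coe s,
      Polynomial.eval₂_at_apply]
    rfl
  have h4 : (n.factorial : ℂ) ≠ 0 := by exact_mod_cast n.factorial_ne_zero
  rw [binCoeff, Complex.ofReal_div, h3, ← h2]
  push_cast
  field_simp

theorem binCoeff_succ (s : ℝ) (n : ℕ) :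
    binCoeff s (n + 1) * (n + 1) = s * binCoeff (s + 1) n := by
  unfold binCoeff
  rw [ascPochhammer_succ_left, Nat.factorial_succ]
  simp [Polynomial.eval_comp]
  field_simp

theorem hasSum_desc (s : ℝ) {x : ℂ} (hx : ‖x‖ < 1) (k : ℕ) :
    HasSum (fun n => ((binCoeff s n : ℝ) : ℂ) * (n.descFactorial k : ℂ) * x ^ (n - k))
      ((((ascPochhammer ℝ k).eval s : ℝ) : ℂ) * (1 - x) ^ (-(s : ℂ)) * ((1 - x) ^ k)⁻¹) := by
  induction k generalizing s with
  | zero => simpa using hasSum_binCoeff s hx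
  | succ k ih =>
    have h1 : (1 - x) ≠ 0 := by
      intro h
      have : x = 1 := by linear_combination -h
      simp [this] at hx
    rw [← hasSum_nat_add_iff' 1]
    have h := (ih (s + 1)).mul_left (s : ℂ)
    refine hasSum_of_eq h (fun n => ?_) ?_
    · rw [Nat.succ_descFactorial_succ, Nat.add_sub_add_right]
      have := congrArg (fun t : ℝ => (t : ℂ)) (binCoeff_succ s n)
      push_cast at this ⊢
      linear_combination (n.descFactorial k : ℂ) * x ^ (n - k) * this
    · rw [ascPochhammer_succ_left]
      simp [Polynomial.eval_comp]
      rw [show -1 + -(s : ℂ) = -(s : ℂ) - 1 by ring, Complex.cpow_sub _ _ h1, Complex.cpow_one,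
        pow_succ]
      field_simp

/-- The mixed derivatives `∂_z^k ∂_y^l` of `(1 - z y) ^ (-s)` for `k, l ≤ 2`. -/
def mixed (s : ℝ) (z y : ℂ) (k l : ℕ) : ℂ :=
  let F : ℕ → ℂ := fun i =>
    (((ascPochhammer ℝ i).eval s : ℝ) : ℂ) * (1 - z * y) ^ (-(s : ℂ)) * ((1 - z * y) ^ i)⁻¹
  match k, l with
  | 0, 0 => F 0
  | 0, 1 => z * F 1
  | 1, 0 => y * F 1
  | 1, 1 => F 1 + z * y * F 2
  | 0, 2 => z ^ 2 * F 2
  | 2, 0 => y ^ 2 * F 2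
  | 1, 2 => 2 * z * F 2 + z ^ 2 * y * F 3
  | 2, 1 => 2 * y * F 2 + z * y ^ 2 * F 3
  | 2, 2 => 2 * F 2 + 4 * (z * y) * F 3 + (z * y) ^ 2 * F 4
  | _, _ => 0

theorem hasSum_mixed (s : ℝ) {z y : ℂ} (h : ‖z * y‖ < 1) {k l : ℕ} (hk : k ≤ 2) (hl : l ≤ 2) :
    HasSum (fun n => (binCoeff s n : ℂ) *
      ((n.descFactorial k * z ^ (n - k)) * (n.descFactorial l * y ^ (n - l)))) (mixed s z y k l) := by
  have F := hasSum_desc s h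
  interval_cases k <;> interval_cases l <;> unfold mixed
  · refine hasSum_of_eq (F 0) (fun n => ?_) rfl
    simp [mul_pow]
  · refine hasSum_of_eq ((F 1).mul_left z) (fun n => ?_) rfl
    rcases n with _ | n <;> simp; ring
  · refine hasSum_of_eq ((F 2).mul_left (z ^ 2)) (fun n => ?_) rfl
    rcases n with _ | _ | n <;> simp [Nat.descFactorial]; ring
  · refine hasSum_of_eq ((F 1).mul_left y) (fun n => ?_) rfl
    rcases n with _ | n <;> simp; ring
  · refine hasSum_of_eq ((F 1).add ((F 2).mul_left (z * y))) (fun n => ?_) rfl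
    rcases n with _ | _ | n <;> simp [Nat.descFactorial]; ring
  · refine hasSum_of_eq (((F 2).mul_left (2 * z)).add ((F 3).mul_left (z ^ 2 * y)))
      (fun n => ?_) rfl
    rcases n with _ | _ | _ | n <;> simp [Nat.descFactorial] <;> ring
  · refine hasSum_of_eq ((F 2).mul_left (y ^ 2)) (fun n => ?_) rfl
    rcases n with _ | _ | n <;> simp [Nat.descFactorial]; ring
  · refine hasSum_of_eq (((F 2).mul_left (2 * y)).add ((F 3).mul_left (z * y ^ 2)))
      (fun n => ?_) rfl
    rcases n with _ | _ | _ | n <;> simp [Nat.descFactorial] <;> ring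
  · refine hasSum_of_eq ((((F 2).mul_left 2).add ((F 3).mul_left (4 * (z * y)))).add
      ((F 4).mul_left ((z * y) ^ 2))) (fun n => ?_) rfl
    rcases n with _ | _ | _ | _ | n <;> simp [Nat.descFactorial] <;> ring

theorem exp_smul_shift_two (w : ℂ) :
    NormedSpace.exp (w • shift 2) = !![1, 0, 0; w, 1, 0; w ^ 2, 2 * w, 1] := by
  have h3 : (w • shift 2) ^ 3 = 0 := by
    ext i j
    fin_cases i <;> fin_cases j <;> simp [shift, pow_succ, Matrix.mul_apply, Fin.sum_univ_three]
  rw [NormedSpace.exp_eq_tsum ℂ]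
  have : ∀ n ∉ Finset.range 3, ((n.factorial : ℂ)⁻¹) • (w • shift 2) ^ n = 0 := by
    intro n hn
    rw [Finset.mem_range, not_lt] at hn
    rw [← Nat.add_sub_cancel' hn, pow_add, h3, zero_mul, smul_zero]
  dsimp only
  rw [tsum_eq_sum this]
  ext i j
  fin_cases i <;> fin_cases j <;>
    simp [shift, pow_succ, Matrix.mul_apply, Fin.sum_univ_three, Finset.sum_range_succ,
      Nat.factorial] <;> ring

theorem exp_smul_shift_two_star (z : ℂ) :
    NormedSpace.exp (z • (shift 2)ᴴ) = !![1, z, z ^ 2; 0, 1, 2 * z; 0, 0, 1] := by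
  have h : z • (shift 2)ᴴ = (conj z • shift 2)ᴴ := by simp [Matrix.conjTranspose_smul]
  rw [h, Matrix.exp_conjTranspose, exp_smul_shift_two]
  ext i j
  fin_cases i <;> fin_cases j <;> simp

/-- The weight `binom(l, j) / (2 λⱼ)_{l - j}` for `j ≤ l`, and `0` otherwise. -/
def weight (p : Param 2) (j l : ℕ) : ℝ :=
  if j ≤ l then (l.choose j : ℝ) / (ascPochhammer ℝ (l - j)).eval (twoLam p j) else 0

set_option maxHeartbeats 1000000 in
theorem kernel_two_eq (p : Param 2) {z w : ℂ} (hzw : ‖z * conj w‖ < 1) (l k : Fin 3) :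
    kernel p z w l k = ∑ j : Fin 3, ((p.mu j ^ 2 * weight p j l * weight p j k : ℝ) : ℂ) *
      mixed (twoLam p j) z (conj w) ((l : ℕ) - j) ((k : ℕ) - j) := by
  obtain ⟨lam, mu, h2, h0, hmu⟩ := p
  have hx : 1 - z * conj w ≠ 0 := by
    intro h
    rw [← sub_eq_zero.mp h] at hzw
    simp at hzw
  have e0 : (1 - z * conj w) ^ (-(2 * (lam : ℂ)) - 2) =
      (1 - z * conj w) ^ (2 - 2 * (lam : ℂ)) * ((1 - z * conj w) ^ 4)⁻¹ := by
    rw [show -(2 * (lam : ℂ)) - 2 = (2 - 2 * (lam : ℂ)) - (4 : ℕ) by push_cast; ring,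
      Complex.cpow_sub _ _ hx, Complex.cpow_natCast, div_eq_mul_inv]
  have e1 : (1 - z * conj w) ^ (-2 + (2 - 2 * (lam : ℂ))) =
      (1 - z * conj w) ^ (2 - 2 * (lam : ℂ)) * ((1 - z * conj w) ^ 2)⁻¹ := by
    rw [show -2 + (2 - 2 * (lam : ℂ)) = (2 - 2 * (lam : ℂ)) - (2 : ℕ) by push_cast; ring,
      Complex.cpow_sub _ _ hx, Complex.cpow_natCast, div_eq_mul_inv]
  have e2 : (1 - z * conj w) ^ (-(2 * 2) + (2 - 2 * (lam : ℂ))) =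
      (1 - z * conj w) ^ (2 - 2 * (lam : ℂ)) * ((1 - z * conj w) ^ 4)⁻¹ := by
    rw [show -(2 * 2) + (2 - 2 * (lam : ℂ)) = (2 - 2 * (lam : ℂ)) - (4 : ℕ) by push_cast; ring,
      Complex.cpow_sub _ _ hx, Complex.cpow_natCast, div_eq_mul_inv]
  have hl : (2 : ℝ) < 2 * lam := by simpa using h2
  have d0 : (2 * (lam : ℂ) - 2) ≠ 0 := by
    have : (2 * lam - 2 : ℝ) ≠ 0 := by linarith
    exact_mod_cast this
  have d1 : (2 * (lam : ℂ) - 2 + 1) ≠ 0 := by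
    have : (2 * lam - 2 + 1 : ℝ) ≠ 0 := by linarith
    exact_mod_cast this
  have d2 : (2 * (lam : ℂ)) ≠ 0 := by
    have : (2 * lam : ℝ) ≠ 0 := by linarith
    exact_mod_cast this
  have d3 : (2 * (lam : ℂ) - 1) ≠ 0 := by
    have : (2 * lam - 1 : ℝ) ≠ 0 := by linarith
    exact_mod_cast this
  have hp (s : ℝ) : (ascPochhammer ℝ 2).eval s = s * (s + 1) := by
    simp [ascPochhammer_succ_right]
  have hp3 (s : ℝ) : (ascPochhammer ℝ 3).eval s = s * (s + 1) * (s + 2) := by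
    simp [ascPochhammer_succ_right]
  have hp4 (s : ℝ) : (ascPochhammer ℝ 4).eval s = s * (s + 1) * (s + 2) * (s + 3) := by
    simp [ascPochhammer_succ_right]
  unfold kernel
  rw [exp_smul_shift_two, exp_smul_shift_two_star]
  fin_cases l <;> fin_cases k <;>
    simp [Matrix.mul_apply, Fin.sum_univ_three, matD, matB, Matrix.diagonal_apply, vecD, coeffL,
      Matrix.mulVec, dotProduct, mixed, weight, twoLam, h0, hp, hp3, hp4, Nat.factorial,
      e0, e1, e2] <;>
    generalize (1 - z * conj w) ^ (2 - 2 * (lam : ℂ)) = Q <;>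
    generalize conj w = y at * <;>
    generalize 2 * (lam : ℂ) = b at * <;>
    field_simp
  all_goals ring

instance fact_posSemidef (p : Param 2) : Fact (kernelCLM p).PosSemidef := ⟨by
  refine posSemidef_of_hasSum (kernel p) (fun (j : Fin 3) n z l =>
    ((√(binCoeff (twoLam p j) n) * (p.mu j * weight p j l) : ℝ) : ℂ) *
      ((n.descFactorial ((l : ℕ) - j) : ℂ) * z ^ (n - ((l : ℕ) - j)))) fun x y l k => ?_
  have hxy : ‖(x : ℂ) * conj (y : ℂ)‖ < 1 := by
    rw [norm_mul, RCLike.norm_conj]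
    exact mul_lt_one_of_nonneg_of_lt_one_left (norm_nonneg _) x.norm_lt_one y.norm_lt_one.le
  rw [kernel_two_eq p hxy]
  refine hasSum_sum fun j _ => ?_
  have hs : 0 < twoLam p j := by
    have := p.lt_two_mul_lam
    have : (0 : ℝ) ≤ (j : ℕ) := Nat.cast_nonneg _
    unfold twoLam
    linarith
  refine hasSum_of_eq ((hasSum_mixed (twoLam p j) hxy (k := (l : ℕ) - j) (l := (k : ℕ) - j)
    (by omega) (by omega)).mul_left _) (fun n => ?_) rfl
  have hq := Real.mul_self_sqrt (binCoeff_nonneg hs n)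
  have hq' := congrArg (fun t : ℝ => (t : ℂ)) hq
  simp only [Complex.ofReal_mul] at hq'
  simp only [map_mul, map_pow, Complex.conj_ofReal, map_natCast]
  push_cast
  linear_combination (p.mu j * weight p j l * (p.mu j * weight p j k) *
    ((n.descFactorial ((l : ℕ) - j) : ℂ) * x ^ (n - ((l : ℕ) - j))) *
    ((n.descFactorial ((k : ℕ) - j) : ℂ) * conj (y : ℂ) ^ (n - ((k : ℕ) - j))) : ℂ) * hq'⟩

/-- The Hilbert space of `ℂ³`-valued functions on the unit disc with reproducing kernel
`K^{(λ, μ)}`. -/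
abbrev Space (p : Param 2) : Type := RKHS.OfKernel (kernelCLM p)

/-- The operator of multiplication by the coordinate function `z` on a reproducing kernel Hilbert
space of vector valued functions on the unit disc, with its natural domain
`{f | z f ∈ H}`: `M f = z f`. (It is everywhere defined when multiplication by `z` preserves `H`.) -/
def mulOp (H : Type*) {V : Type*} [NormedAddCommGroup V] [InnerProductSpace ℂ V]
    [NormedAddCommGroup H] [InnerProductSpace ℂ H] [RKHS ℂ H Complex.UnitDisc V] :
    H →ₗ.[ℂ] H where
  domain :=
    { carrier := {f | ∃ g : H, ∀ z : Complex.UnitDisc, g z = (z : ℂ) • f z}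
      add_mem' := by
        rintro a b ⟨g, hg⟩ ⟨k, hk⟩
        exact ⟨g + k, fun z => by simp [hg, hk]⟩
      zero_mem' := ⟨0, fun z => by simp⟩
      smul_mem' := by
        rintro c a ⟨g, hg⟩
        exact ⟨c • g, fun z => by simp [hg, smul_comm c]⟩ }
  toFun :=
    { toFun := fun f => f.2.choose
      map_add' := fun f k => RKHS.ext fun z => by
        refine ((f + k).2.choose_spec z).trans ?_
        simp [f.2.choose_spec z, k.2.choose_spec z]
      map_smul' := fun c f => RKHS.ext fun z => by
        refine ((c • f).2.choose_spec z).trans ?_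
        simp [f.2.choose_spec z, smul_comm c] }

/-- Unitary equivalence of operators `A` on `H` and `B` on `H'`: a unitary `U : H → H'` maps the
domain of `A` onto the domain of `B`, and `B U = U A`. -/
def UnitarilyEquivalent {H H' : Type*} [NormedAddCommGroup H] [InnerProductSpace ℂ H]
    [NormedAddCommGroup H'] [InnerProductSpace ℂ H'] (A : H →ₗ.[ℂ] H) (B : H' →ₗ.[ℂ] H') : Prop :=
  ∃ U : H ≃ₗᵢ[ℂ] H', (∀ f : H, f ∈ A.domain ↔ U f ∈ B.domain) ∧
    ∀ (f : A.domain) (g : B.domain), (g : H') = U f → B g = U (A f)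

/-- The Wirtinger derivative `∂f/∂z = (∂f/∂x - i ∂f/∂y) / 2`. -/
def dz (f : ℂ → ℂ) (z : ℂ) : ℂ :=
  (fderiv ℝ f z 1 - Complex.I * fderiv ℝ f z Complex.I) / 2

/-- The Wirtinger derivative `∂f/∂z̄ = (∂f/∂x + i ∂f/∂y) / 2`. -/
def dzbar (f : ℂ → ℂ) (z : ℂ) : ℂ :=
  (fderiv ℝ f z 1 + Complex.I * fderiv ℝ f z Complex.I) / 2

/-- The entrywise derivative `∂/∂z` of a matrix valued function. -/
def matDz {n : ℕ} (F : ℂ → Matrix (Fin n) (Fin n) ℂ) (z : ℂ) : Matrix (Fin n) (Fin n) ℂ :=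
  Matrix.of fun i j => dz (fun ζ => F ζ i j) z

/-- The entrywise derivative `∂/∂z̄` of a matrix valued function. -/
def matDzbar {n : ℕ} (F : ℂ → Matrix (Fin n) (Fin n) ℂ) (z : ℂ) : Matrix (Fin n) (Fin n) ℂ :=
  Matrix.of fun i j => dzbar (fun ζ => F ζ i j) z

/-- The curvature `∂̄ (h⁻¹ ∂h)` of a Hermitian holomorphic bundle, in a holomorphic frame with
metric (Gram matrix) `h`. -/
def curvature {n : ℕ} (h : ℂ → Matrix (Fin n) (Fin n) ℂ) (z : ℂ) : Matrix (Fin n) (Fin n) ℂ :=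
  matDzbar (fun ζ => (h ζ)⁻¹ * matDz h ζ) z

/-- The covariant derivative of order `(0, 1)` of a bundle map, given by the matrix function `Θ` in
a holomorphic frame: `Θ_{z̄} = ∂̄ Θ`. -/
def covDerivBar {n : ℕ} (Θ : ℂ → Matrix (Fin n) (Fin n) ℂ) (z : ℂ) : Matrix (Fin n) (Fin n) ℂ :=
  matDzbar Θ z

/-- The normalized kernel
`K(0,0)^{1/2} K(z,0)⁻¹ K(z,w) K(0,w)⁻¹ K(0,0)^{1/2}`. -/
def normalize {n : ℕ} (K : ℂ → ℂ → Matrix (Fin n) (Fin n) ℂ) (z w : ℂ) :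
    Matrix (Fin n) (Fin n) ℂ :=
  CFC.sqrt (K 0 0) * (K z 0)⁻¹ * K z w * (K 0 w)⁻¹ * CFC.sqrt (K 0 0)

/-- The metric `h(z) = K̃(z, z)ᵗ`, where `K̃` is the normalized kernel. -/
def metric {m : ℕ} (p : Param m) (z : ℂ) : Matrix (Fin (m + 1)) (Fin (m + 1)) ℂ :=
  (normalize (kernel p) z z)ᵀ

/-- The curvature of the metric `h(z) = K̃(z, z)ᵗ`. -/
def curv {m : ℕ} (p : Param m) (z : ℂ) : Matrix (Fin (m + 1)) (Fin (m + 1)) ℂ :=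
  curvature (metric p) z

/-- The covariant derivative of order `(0, 1)` of the curvature. -/
def curvBar {m : ℕ} (p : Param m) (z : ℂ) : Matrix (Fin (m + 1)) (Fin (m + 1)) ℂ :=
  covDerivBar (curv p) z

/-- `U` is a unitary map from `(ℂⁿ, h)` to `(ℂⁿ, h')`, where a Gram matrix `g` gives `ℂⁿ` the inner
product with `‖x‖² = x* g x`. -/
def IsUnitaryMap {n : ℕ} (h h' U : Matrix (Fin n) (Fin n) ℂ) : Prop :=
  IsUnit U ∧ Uᴴ * h' * U = h

/-- The curvatures are unitarily equivalent at `z`: a unitary map between the fibres over `z`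
intertwines them. -/
def CurvEquivAt {m : ℕ} (p q : Param m) (z : ℂ) : Prop :=
  ∃ U : Matrix (Fin (m + 1)) (Fin (m + 1)) ℂ,
    IsUnitaryMap (metric p z) (metric q z) U ∧ U * curv p z = curv q z * U

end KM

end

/-!
The curvature and its `(0, 1)`-derivative at the origin can be computed explicitly, and already the
values at the origin rule out a simultaneous intertwiner.

*Reduction to power series coefficients.* The metric is `h(z) = H(z, z̄)` with `H` holomorphic in
two independent variables near the origin, and the normalization of the kernel gives `H(0, w) = 1`.
Hence the factor `h⁻¹` is invisible to antiholomorphic derivatives of `h⁻¹ ∂h` at the origin, and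
`𝒦(0)` and `𝒦_{z̄}(0)` are the first and second derivatives in `w`, at `w = 0`, of `∂_z H(0, w)`
(`curvature_zero_of_polarization`).

*The values.* Put `a = d₀ / d₁` and `b = 4 d₁ / d₂`. Then
`𝒦(0) = diag (2 λ - 2 - a, 2 λ + a - b, 2 λ + 2 + b)` (`curv_zero`), and `𝒦_{z̄}(0)` is a weighted
shift whose two weights are non-zero multiples of `-1 - a + b / 2` and `-2 + a - 2 b`
(`curvBar_zero`).

*Conclusion.* An intertwiner `L` of the diagonal matrices `𝒦(0)` forces the same spectrum. The
trace determines `λ`, and since `a, b > 0` the first and the last eigenvalue lie on opposite sides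
of `[2 λ - 2, 2 λ + 2]`; so either `a` and `b` agree for both parameters, or the middle eigenvalue
is interchanged with one of its neighbours (`curvEigenvalue_cases`). In the first case the
parameters, and so the operators, coincide. In the second case the eigenvalues are distinct, so `L`
is a permutation matrix up to scalars, for a transposition that does not respect the direction of
the shift; then `L` can intertwine the matrices `𝒦_{z̄}(0)` only if both weights vanish
(`shift_eq_zero_of_swap_one_two`, `shift_eq_zero_of_swap_zero_one`), which would mean
`b = 2 + 2 a` and `a = 2 + 2 b`, contradicting positivity.
-/

open scoped ComplexConjugate Matrix MatrixOrder ComplexOrder Topology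

noncomputable section

namespace KM

/-! ### Wirtinger derivatives through polarization -/

/-- The restriction of a function of two complex variables to the anti-diagonal
`{(z, z̄)}` has real derivative `v ↦ F' (v, v̄)`. -/
theorem fderiv_antidiagonal_apply {F : ℂ × ℂ → ℂ} {z : ℂ}
    (hF : DifferentiableAt ℂ F (z, conj z)) (v : ℂ) :
    fderiv ℝ (fun ζ => F (ζ, conj ζ)) z v = fderiv ℂ F (z, conj z) (v, conj v) := by
  have h1 : HasFDerivAt (fun ζ : ℂ => (ζ, conj ζ))
      ((ContinuousLinearMap.id ℝ ℂ).prod (Complex.conjCLE : ℂ →L[ℝ] ℂ)) z :=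
    (hasFDerivAt_id z).prodMk Complex.conjCLE.hasFDerivAt
  have h2 := (hF.hasFDerivAt.restrictScalars ℝ).comp z h1
  rw [show (fun ζ => F (ζ, conj ζ)) = F ∘ fun ζ : ℂ => (ζ, conj ζ) from rfl, h2.fderiv]
  simp

theorem dz_antidiagonal {F : ℂ × ℂ → ℂ} {z : ℂ} (hF : DifferentiableAt ℂ F (z, conj z)) :
    dz (fun ζ => F (ζ, conj ζ)) z = fderiv ℂ F (z, conj z) (1, 0) := by
  set T := fderiv ℂ F (z, conj z) with hT
  have e1 : T (1, conj 1) = T (1, 0) + T (0, 1) := by rw [← map_add]; simp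
  have e2 : T (Complex.I, conj Complex.I) = Complex.I * T (1, 0) - Complex.I * T (0, 1) := by
    rw [← smul_eq_mul, ← smul_eq_mul, ← map_smul, ← map_smul, ← map_sub]; simp
  rw [dz, fderiv_antidiagonal_apply hF, fderiv_antidiagonal_apply hF, ← hT, e1, e2]
  linear_combination (-(T (1, 0)) + T (0, 1)) / 2 * Complex.I_sq

theorem dzbar_antidiagonal {F : ℂ × ℂ → ℂ} {z : ℂ} (hF : DifferentiableAt ℂ F (z, conj z)) :
    dzbar (fun ζ => F (ζ, conj ζ)) z = fderiv ℂ F (z, conj z) (0, 1) := by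
  set T := fderiv ℂ F (z, conj z) with hT
  have e1 : T (1, conj 1) = T (1, 0) + T (0, 1) := by rw [← map_add]; simp
  have e2 : T (Complex.I, conj Complex.I) = Complex.I * T (1, 0) - Complex.I * T (0, 1) := by
    rw [← smul_eq_mul, ← smul_eq_mul, ← map_smul, ← map_smul, ← map_sub]; simp
  rw [dzbar, fderiv_antidiagonal_apply hF, fderiv_antidiagonal_apply hF, ← hT, e1, e2]
  linear_combination (T (1, 0) - T (0, 1)) / 2 * Complex.I_sq

theorem dzbar_congr {f g : ℂ → ℂ} {z : ℂ} (h : f =ᶠ[𝓝 z] g) : dzbar f z = dzbar g z := by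
  rw [dzbar, dzbar, h.fderiv_eq]

theorem tendsto_antidiagonal : Filter.Tendsto (fun z : ℂ => (z, conj z)) (𝓝 0) (𝓝 (0, 0)) := by
  have : Continuous fun z : ℂ => (z, conj z) := by fun_prop
  simpa using this.tendsto 0

theorem fderiv_apply_snd {F : ℂ × ℂ → ℂ} {z w : ℂ} (hF : DifferentiableAt ℂ F (z, w)) :
    fderiv ℂ F (z, w) (0, 1) = deriv (fun v => F (z, v)) w := by
  have h := hF.hasFDerivAt.comp_hasDerivAt w ((hasDerivAt_const w z).prodMk (hasDerivAt_id w))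
  exact h.deriv.symm

theorem fderiv_apply_fst {F : ℂ × ℂ → ℂ} {z w : ℂ} (hF : DifferentiableAt ℂ F (z, w)) :
    fderiv ℂ F (z, w) (1, 0) = deriv (fun v => F (v, w)) z := by
  have h := hF.hasFDerivAt.comp_hasDerivAt z ((hasDerivAt_id z).prodMk (hasDerivAt_const z w))
  exact h.deriv.symm

theorem analyticAt_fderiv_apply {F : ℂ × ℂ → ℂ} {x : ℂ × ℂ} (hF : AnalyticAt ℂ F x)
    (v : ℂ × ℂ) : AnalyticAt ℂ (fun y => fderiv ℂ F y v) x :=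
  ((ContinuousLinearMap.apply ℂ ℂ v).analyticAt _).comp hF.fderiv

theorem analyticAt_matrix_inv {n : ℕ} {H : ℂ × ℂ → Matrix (Fin n) (Fin n) ℂ} {x : ℂ × ℂ}
    (hH : ∀ i j, AnalyticAt ℂ (fun y => H y i j) x) (hx : (H x).det ≠ 0) (i j : Fin n) :
    AnalyticAt ℂ (fun y => (H y)⁻¹ i j) x := by
  have hdet : ∀ G : ℂ × ℂ → Matrix (Fin n) (Fin n) ℂ,
      (∀ i j, AnalyticAt ℂ (fun y => G y i j) x) → AnalyticAt ℂ (fun y => (G y).det) x := by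
    intro G hG
    simp only [Matrix.det_apply']
    exact Finset.analyticAt_fun_sum _ fun σ _ => analyticAt_const.mul
      (Finset.analyticAt_fun_prod _ fun k _ => hG _ _)
  simp only [Matrix.inv_def, Ring.inverse_eq_inv', Matrix.smul_apply, smul_eq_mul,
    Matrix.adjugate_apply]
  refine ((hdet H hH).inv hx).mul (hdet _ fun k l => ?_)
  by_cases hk : k = j
  · subst hk
    simpa using analyticAt_const
  · simpa [Matrix.updateRow_ne hk] using hH k l

/-- If the metric extends to a holomorphic function `H` of the independent variables `z` and
`w = z̄`, and `H (0, w) = 1`, then the factor `h⁻¹` does not contribute to the antiholomorphic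
derivatives of `h⁻¹ ∂h` at the origin. -/
theorem curvature_zero_of_polarization {n : ℕ} {H : ℂ × ℂ → Matrix (Fin n) (Fin n) ℂ}
    (hH : ∀ i j, AnalyticAt ℂ (fun y => H y i j) (0, 0)) (h1 : ∀ w, H (0, w) = 1)
    {Z : Fin n → Fin n → ℂ → ℂ}
    (hZ : ∀ i j w, HasDerivAt (fun z => H (z, w) i j) (Z i j w) 0) :
    curvature (fun z => H (z, conj z)) 0 = Matrix.of (fun i j => deriv (Z i j) 0) ∧
    covDerivBar (curvature fun z => H (z, conj z)) 0 =
      Matrix.of fun i j => deriv (deriv (Z i j)) 0 := by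
  let G : Fin n → Fin n → ℂ × ℂ → ℂ := fun i j y =>
    ∑ k, (H y)⁻¹ i k * fderiv ℂ (fun y => H y k j) y (1, 0)
  have hG : ∀ i j, AnalyticAt ℂ (G i j) (0, 0) := fun i j =>
    Finset.analyticAt_fun_sum _ fun k _ =>
      (analyticAt_matrix_inv hH (by simp [h1]) i k).mul (analyticAt_fderiv_apply (hH k j) _)
  have hcurv : ∀ i j, ∀ᶠ z in 𝓝 (0 : ℂ), curvature (fun z => H (z, conj z)) z i j =
      fderiv ℂ (G i j) (z, conj z) (0, 1) := by
    intro i j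
    have e1 : ∀ᶠ z in 𝓝 (0 : ℂ), ((fun ζ => (H (ζ, conj ζ))⁻¹ *
        matDz (fun z => H (z, conj z)) ζ) z) i j = G i j (z, conj z) := by
      have : ∀ᶠ z in 𝓝 (0 : ℂ), ∀ k, AnalyticAt ℂ (fun y => H y k j) (z, conj z) :=
        Filter.eventually_all.mpr fun k =>
          tendsto_antidiagonal.eventually (hH k j).eventually_analyticAt
      filter_upwards [this] with z hz
      simp only [Matrix.mul_apply, G, matDz, Matrix.of_apply]
      refine Finset.sum_congr rfl fun k _ => ?_
      rw [dz_antidiagonal (F := fun y => H y k j) (hz k).differentiableAt]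
    have e2 := tendsto_antidiagonal.eventually (hG i j).eventually_analyticAt
    filter_upwards [e1.eventually_nhds, e2] with z hz hz2
    rw [curvature, matDzbar, Matrix.of_apply, dzbar_congr hz,
      dzbar_antidiagonal hz2.differentiableAt]
  have hline : Filter.Tendsto (fun w : ℂ => ((0 : ℂ), w)) (𝓝 0) (𝓝 (0, 0)) := by
    have : Continuous fun w : ℂ => ((0 : ℂ), w) := by fun_prop
    simpa using this.tendsto 0
  have hGZ : ∀ i j, ∀ᶠ w in 𝓝 (0 : ℂ), G i j (0, w) = Z i j w := by
    intro i j
    have : ∀ᶠ w in 𝓝 (0 : ℂ), ∀ k, AnalyticAt ℂ (fun y => H y k j) (0, w) :=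
      Filter.eventually_all.mpr fun k => hline.eventually (hH k j).eventually_analyticAt
    filter_upwards [this] with w hw
    simp only [G, h1, inv_one, Matrix.one_apply, ite_mul, one_mul, zero_mul, Finset.sum_ite_eq,
      Finset.mem_univ, if_true]
    rw [fderiv_apply_fst (hw i).differentiableAt, (hZ i j w).deriv]
  have hD : ∀ i j, ∀ᶠ w in 𝓝 (0 : ℂ), fderiv ℂ (G i j) (0, w) (0, 1) = deriv (Z i j) w := by
    intro i j
    filter_upwards [(hGZ i j).eventually_nhds,
      hline.eventually (hG i j).eventually_analyticAt] with w hw hw2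
    rw [fderiv_apply_snd hw2.differentiableAt]
    exact Filter.EventuallyEq.deriv_eq hw
  constructor
  · ext i j
    simpa using (hcurv i j).self_of_nhds.trans (by simpa using (hD i j).self_of_nhds)
  · ext i j
    have hA := analyticAt_fderiv_apply (hG i j) (0, 1)
    rw [covDerivBar, matDzbar, Matrix.of_apply, Matrix.of_apply, dzbar_congr (hcurv i j),
      dzbar_antidiagonal (F := fun y => fderiv ℂ (G i j) y (0, 1))
        (by simpa using hA.differentiableAt), map_zero,
      fderiv_apply_snd hA.differentiableAt]
    exact Filter.EventuallyEq.deriv_eq (hD i j)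

/-! ### The polarized metric and its derivative -/

theorem analyticAt_matrix_mul {n : ℕ} {A B : ℂ × ℂ → Matrix (Fin n) (Fin n) ℂ} {x : ℂ × ℂ}
    (hA : ∀ i j, AnalyticAt ℂ (fun y => A y i j) x)
    (hB : ∀ i j, AnalyticAt ℂ (fun y => B y i j) x) (i j : Fin n) :
    AnalyticAt ℂ (fun y => (A y * B y) i j) x := by
  simp only [Matrix.mul_apply]
  exact Finset.analyticAt_fun_sum _ fun k _ => (hA i k).mul (hB k j)

theorem hasDerivAt_matrix_mul {n : ℕ} {A B : ℂ → Matrix (Fin n) (Fin n) ℂ}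
    {A' B' : Matrix (Fin n) (Fin n) ℂ} {x : ℂ}
    (hA : ∀ i j, HasDerivAt (fun y => A y i j) (A' i j) x)
    (hB : ∀ i j, HasDerivAt (fun y => B y i j) (B' i j) x) (i j : Fin n) :
    HasDerivAt (fun y => (A y * B y) i j) ((A' * B x + A x * B') i j) x := by
  simp only [Matrix.mul_apply, Matrix.add_apply, ← Finset.sum_add_distrib]
  exact HasDerivAt.fun_sum fun k _ => (hA i k).mul (hB k j)

/-- The matrix `exp (w S)` in rank `3`. -/
def expS (w : ℂ) : Matrix (Fin 3) (Fin 3) ℂ := !![1, 0, 0; w, 1, 0; w ^ 2, 2 * w, 1]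

/-- The matrix `exp (z S*)` in rank `3`. -/
def expT (z : ℂ) : Matrix (Fin 3) (Fin 3) ℂ := !![1, z, z ^ 2; 0, 1, 2 * z; 0, 0, 1]

theorem expS_zero : expS 0 = 1 := by
  ext i j
  fin_cases i <;> fin_cases j <;> simp [expS]

theorem expT_zero : expT 0 = 1 := by
  ext i j
  fin_cases i <;> fin_cases j <;> simp [expT]

theorem expS_mul_neg (w : ℂ) : expS w * expS (-w) = 1 := by
  ext i j
  fin_cases i <;> fin_cases j <;> simp [expS, Matrix.mul_apply, Fin.sum_univ_three]
  ring

theorem expT_mul_neg (w : ℂ) : expT w * expT (-w) = 1 := by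
  ext i j
  fin_cases i <;> fin_cases j <;> simp [expT, Matrix.mul_apply, Fin.sum_univ_three]
  ring

theorem diagonal_fin_three (d : Fin 3 → ℂ) :
    Matrix.diagonal d = !![d 0, 0, 0; 0, d 1, 0; 0, 0, d 2] := by
  ext i j
  fin_cases i <;> fin_cases j <;> simp

theorem matD_two (x : ℂ) : matD 2 x = !![(1 - x) ^ 2, 0, 0; 0, 1 - x, 0; 0, 0, 1] := by
  ext i j
  fin_cases i <;> fin_cases j <;> simp [matD]

theorem matD_two_zero : matD 2 0 = 1 := by
  ext i j
  fin_cases i <;> fin_cases j <;> simp [matD_two]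

/-- The left factor of the normalized kernel without its scalar power, with `r = B^{1/2}`:
`exp(-z S*) B⁻¹ D(z w) exp(w S) B exp(z S*) D(z w)`. -/
def core (r : Fin 3 → ℂ) (z w : ℂ) : Matrix (Fin 3) (Fin 3) ℂ :=
  expT (-z) * Matrix.diagonal (fun i => (r i ^ 2)⁻¹) *
    (matD 2 (z * w) * (expS w * Matrix.diagonal fun i => r i ^ 2) * expT z * matD 2 (z * w))

/-- The transposed normalized kernel as a function of the independent variables `z` and `w = z̄`,
where `r` is the diagonal of `B^{1/2}` and `c` the exponent of `1 - z w`. -/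
def polarMetric (c : ℂ) (r : Fin 3 → ℂ) (y : ℂ × ℂ) : Matrix (Fin 3) (Fin 3) ℂ :=
  (1 - y.1 * y.2) ^ c •
    (Matrix.diagonal r * core r y.1 y.2 *
      (Matrix.diagonal (fun i => (r i ^ 2)⁻¹) * expS (-y.2) * Matrix.diagonal r))ᵀ

theorem polarMetric_zero (c : ℂ) {r : Fin 3 → ℂ} (hr : ∀ i, r i ≠ 0) (w : ℂ) :
    polarMetric c r (0, w) = 1 := by
  have h1 : Matrix.diagonal (fun i => r i ^ 2) * Matrix.diagonal (fun i => (r i ^ 2)⁻¹) = 1 := by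
    rw [Matrix.diagonal_mul_diagonal, ← Matrix.diagonal_one]
    congr 1; ext i; simp [hr i]
  have h2 : Matrix.diagonal r * Matrix.diagonal (fun i => (r i ^ 2)⁻¹) * Matrix.diagonal r = 1 := by
    rw [Matrix.diagonal_mul_diagonal, Matrix.diagonal_mul_diagonal, ← Matrix.diagonal_one]
    congr 1; ext i; have := hr i; field_simp
  have h : Matrix.diagonal r * core r 0 w *
      (Matrix.diagonal (fun i => (r i ^ 2)⁻¹) * expS (-w) * Matrix.diagonal r) = 1 := by
    rw [core, neg_zero, expT_zero, zero_mul, matD_two_zero]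
    simp only [one_mul, mul_one]
    calc _ = Matrix.diagonal r * Matrix.diagonal (fun i => (r i ^ 2)⁻¹) * (expS w *
          (Matrix.diagonal (fun i => r i ^ 2) * Matrix.diagonal (fun i => (r i ^ 2)⁻¹)) *
          expS (-w)) * Matrix.diagonal r := by simp only [mul_assoc]
      _ = 1 := by rw [h1, mul_one, expS_mul_neg, mul_one, h2]
  simp [polarMetric, h]

theorem analyticAt_polarMetric (c : ℂ) (r : Fin 3 → ℂ) (i j : Fin 3) :
    AnalyticAt ℂ (fun y => polarMetric c r y i j) (0, 0) := by
  have hc : AnalyticAt ℂ (fun y : ℂ × ℂ => (1 - y.1 * y.2) ^ c) (0, 0) :=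
    (by fun_prop : AnalyticAt ℂ (fun y : ℂ × ℂ => 1 - y.1 * y.2) (0, 0)).cpow
      analyticAt_const (by simp)
  have hD : ∀ i j, AnalyticAt ℂ (fun y : ℂ × ℂ => matD 2 (y.1 * y.2) i j) (0, 0) := by
    intro i j
    simp only [matD, Matrix.diagonal_apply]
    split_ifs <;> fun_prop
  have hconst (A : Matrix (Fin 3) (Fin 3) ℂ) (i j : Fin 3) :
      AnalyticAt ℂ (fun _ : ℂ × ℂ => A i j) (0, 0) := analyticAt_const
  have hT {f : ℂ × ℂ → ℂ} (hf : AnalyticAt ℂ f (0, 0)) (i j : Fin 3) :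
      AnalyticAt ℂ (fun y : ℂ × ℂ => expT (f y) i j) (0, 0) := by
    fin_cases i <;> fin_cases j <;> simp [expT] <;> fun_prop
  have hS {f : ℂ × ℂ → ℂ} (hf : AnalyticAt ℂ f (0, 0)) (i j : Fin 3) :
      AnalyticAt ℂ (fun y : ℂ × ℂ => expS (f y) i j) (0, 0) := by
    fin_cases i <;> fin_cases j <;> simp [expS] <;> fun_prop
  have h1 := analyticAt_matrix_mul (hT analyticAt_fst.neg)
    (hconst (Matrix.diagonal fun i => (r i ^ 2)⁻¹))
  have h2 := analyticAt_matrix_mul (analyticAt_matrix_mul (analyticAt_matrix_mul hD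
    (analyticAt_matrix_mul (hS analyticAt_snd) (hconst (Matrix.diagonal fun i => r i ^ 2))))
    (hT analyticAt_fst)) hD
  have h3 := analyticAt_matrix_mul (analyticAt_matrix_mul (hconst
    (Matrix.diagonal fun i => (r i ^ 2)⁻¹))
    (hS analyticAt_snd.neg)) (hconst (Matrix.diagonal r))
  exact hc.mul (analyticAt_matrix_mul (analyticAt_matrix_mul (hconst (Matrix.diagonal r))
    (analyticAt_matrix_mul h1 h2)) h3 j i)

/-- The derivative of the polarized metric in `z` at `z = 0`, as a function of `w`. -/
def polarDeriv (c : ℂ) (r : Fin 3 → ℂ) (w : ℂ) : Matrix (Fin 3) (Fin 3) ℂ :=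
  let a := r 0 ^ 2 / r 1 ^ 2
  let b := 4 * r 1 ^ 2 / r 2 ^ 2
  !![(-c - 4 - a) * w, r 0 / r 1 * (-1 - a + b / 2) * w ^ 2, r 0 / r 2 * (b - a) * w ^ 3;
    0, (-c - 2 + a - b) * w, r 1 / r 2 * (-2 + a - 2 * b) * w ^ 2;
    0, 0, (-c + b) * w]

set_option maxHeartbeats 1000000 in
theorem hasDerivAt_polarMetric (c : ℂ) {r : Fin 3 → ℂ} (hr : ∀ i, r i ≠ 0) (w : ℂ) (i j : Fin 3) :
    HasDerivAt (fun z => polarMetric c r (z, w) i j) (polarDeriv c r w i j) 0 := by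
  have hc : HasDerivAt (fun z => (1 - z * w) ^ c) (-c * w) 0 := by
    have h := (((hasDerivAt_id (0 : ℂ)).mul_const w).const_sub 1).cpow_const (c := c) (by simp)
    simpa using h
  have hD : ∀ i j, HasDerivAt (fun z => matD 2 (z * w) i j)
      (Matrix.diagonal ![-2 * w, -w, 0] i j) 0 := by
    have h := ((hasDerivAt_id (0 : ℂ)).mul_const w).const_sub 1
    intro i j
    fin_cases i <;> fin_cases j <;> simp [matD, hasDerivAt_const]
    · simpa using h.fun_pow 2
    · simpa using h
  have hconst (A : Matrix (Fin 3) (Fin 3) ℂ) (i j : Fin 3) :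
      HasDerivAt (fun _ : ℂ => A i j) ((0 : Matrix (Fin 3) (Fin 3) ℂ) i j) 0 :=
    hasDerivAt_const _ _
  have hT (s : ℂ) (i j : Fin 3) : HasDerivAt (fun z => expT (s * z) i j)
      (!![0, s, 0; 0, 0, 2 * s; 0, 0, 0] i j) 0 := by
    have h := (hasDerivAt_id (0 : ℂ)).const_mul s
    fin_cases i <;> fin_cases j <;> simp [expT, hasDerivAt_const]
    · simpa using h
    · simpa using h.fun_pow 2
    · simpa using h.const_mul 2
  have h1 := hasDerivAt_matrix_mul (hT (-1)) (hconst (Matrix.diagonal fun i => (r i ^ 2)⁻¹))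
  have h2 := hasDerivAt_matrix_mul (hasDerivAt_matrix_mul (hasDerivAt_matrix_mul hD
    (hconst (expS w * Matrix.diagonal fun i => r i ^ 2))) (hT 1)) hD
  have h3 := hasDerivAt_matrix_mul (hasDerivAt_matrix_mul (hconst (Matrix.diagonal r))
    (hasDerivAt_matrix_mul h1 h2)) (hconst (Matrix.diagonal (fun i => (r i ^ 2)⁻¹) * expS (-w) *
      Matrix.diagonal r)) j i
  have h4 := hc.mul h3
  simp only [one_mul, neg_mul] at h4
  refine h4.congr_deriv ?_
  simp only [diagonal_fin_three, matD_two, expT, expS]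
  have r0 := hr 0
  have r1 := hr 1
  have r2 := hr 2
  fin_cases i <;> fin_cases j <;>
    simp [polarDeriv, r0, r1, r2] <;>
    field_simp <;> ring

/-! ### Identification of the metric -/

theorem vecD_two_apply (p : Param 2) : vecD p 0 = 1 ∧
    vecD p 1 = 1 / (2 * p.lam - 2) + p.mu 1 ^ 2 ∧
    vecD p 2 = 2 / ((2 * p.lam - 2) * (2 * p.lam - 1)) + 4 / (2 * p.lam) * p.mu 1 ^ 2 +
      p.mu 2 ^ 2 := by
  refine And.intro ?_ (And.intro ?_ ?_) <;>
    simp [vecD, coeffL, Matrix.mulVec, dotProduct, Fin.sum_univ_three, p.mu_zero, twoLam,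
      ascPochhammer_succ_right]
  ring_nf

theorem vecD_pos (p : Param 2) (i : Fin 3) : 0 < vecD p i := by
  obtain ⟨h0, h1, h2⟩ := vecD_two_apply p
  have hl : (2 : ℝ) < 2 * p.lam := by simpa using p.lt_two_mul_lam
  have m1 := p.mu_pos 1
  have m2 := p.mu_pos 2
  have e1 : 0 < 2 * p.lam - 2 := by linarith
  have e2 : 0 < 2 * p.lam - 1 := by linarith
  have e3 : 0 < 2 * p.lam := by linarith
  fin_cases i
  · simp [h0]
  · simp only [Fin.mk_one, h1]; positivity
  · simp only [Fin.reduceFinMk, h2]; positivity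

/-- The triangular system `d = L(λ) (μⱼ²)` can be solved for the positive numbers `μⱼ`. -/
theorem Param.eq_of_vecD {p q : Param 2} (hl : p.lam = q.lam) (hd : ∀ i, vecD p i = vecD q i) :
    p = q := by
  obtain ⟨-, p1, p2⟩ := vecD_two_apply p
  obtain ⟨-, q1, q2⟩ := vecD_two_apply q
  have m1 : p.mu 1 ^ 2 = q.mu 1 ^ 2 := by
    have := hd 1
    rw [p1, q1, hl] at this
    linarith
  have m2 : p.mu 2 ^ 2 = q.mu 2 ^ 2 := by
    have := hd 2
    rw [p2, q2, hl, m1] at this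
    linarith
  have h1 := (sq_eq_sq₀ (p.mu_pos 1).le (q.mu_pos 1).le).mp m1
  have h2 := (sq_eq_sq₀ (p.mu_pos 2).le (q.mu_pos 2).le).mp m2
  have h : p.mu = q.mu := by
    ext i
    fin_cases i
    · exact p.mu_zero.trans q.mu_zero.symm
    · exact h1
    · exact h2
  cases p
  cases q
  simp only at hl h
  subst hl h
  rfl

/-- The diagonal of `B^{1/2}`. -/
def sqrtD (p : Param 2) (i : Fin 3) : ℂ := (√(vecD p i) : ℝ)

theorem sqrtD_sq (p : Param 2) (i : Fin 3) : sqrtD p i ^ 2 = vecD p i := by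
  rw [sqrtD, ← Complex.ofReal_pow, Real.sq_sqrt (vecD_pos p i).le]

theorem sqrtD_ne_zero (p : Param 2) (i : Fin 3) : sqrtD p i ≠ 0 := by
  rw [sqrtD, Complex.ofReal_ne_zero]
  exact (Real.sqrt_pos.mpr (vecD_pos p i)).ne'

theorem matB_eq (p : Param 2) : matB p = Matrix.diagonal fun i => sqrtD p i ^ 2 := by
  simp only [matB, sqrtD_sq]

theorem sqrt_matB (p : Param 2) : CFC.sqrt (matB p) = Matrix.diagonal (sqrtD p) := by
  refine CFC.sqrt_unique ?_ ?_
  · rw [matB_eq, Matrix.diagonal_mul_diagonal]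
    simp only [sq]
  · rw [Matrix.nonneg_iff_posSemidef, Matrix.posSemidef_diagonal_iff]
    intro i
    rw [sqrtD]
    exact_mod_cast Real.sqrt_nonneg _

theorem matB_inv (p : Param 2) :
    (matB p)⁻¹ = Matrix.diagonal fun i => (sqrtD p i ^ 2)⁻¹ := by
  refine Matrix.inv_eq_right_inv ?_
  rw [matB_eq, Matrix.diagonal_mul_diagonal, ← Matrix.diagonal_one]
  congr 1
  ext i
  simp [sqrtD_ne_zero p i]

theorem kernel_two (p : Param 2) (z w : ℂ) :
    kernel p z w = (1 - z * conj w) ^ (-2 * (p.lam : ℂ) - 2) •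
      (matD 2 (z * conj w) * expS (conj w) * matB p * expT z * matD 2 (z * conj w)) := by
  rw [kernel, exp_smul_shift_two, exp_smul_shift_two_star, expS, expT]
  norm_num

theorem metric_eq_polarMetric (p : Param 2) :
    metric p = fun z => polarMetric (-2 * (p.lam : ℂ) - 2) (sqrtD p) (z, conj z) := by
  have k00 : kernel p 0 0 = matB p := by simp [kernel_two, matD_two_zero, expS_zero, expT_zero]
  have kz0 (z : ℂ) : kernel p z 0 = matB p * expT z := by
    simp [kernel_two, matD_two_zero, expS_zero]
  have k0w (w : ℂ) : kernel p 0 w = expS (conj w) * matB p := by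
    simp [kernel_two, matD_two_zero, expT_zero]
  ext1 z
  rw [metric, normalize, k00, kz0, k0w, Matrix.mul_inv_rev, Matrix.mul_inv_rev,
    Matrix.inv_eq_right_inv (expT_mul_neg z), Matrix.inv_eq_right_inv (expS_mul_neg (conj z)),
    matB_inv, sqrt_matB, kernel_two, matB_eq, polarMetric, core, Matrix.mul_smul,
    Matrix.smul_mul, Matrix.smul_mul, Matrix.transpose_smul]
  simp only [mul_assoc]

/-! ### The curvature and its derivative at the origin -/

/-- The ratio `d₀ / d₁`. -/
def ratioA (p : Param 2) : ℝ := vecD p 0 / vecD p 1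

/-- The ratio `4 d₁ / d₂`. -/
def ratioB (p : Param 2) : ℝ := 4 * vecD p 1 / vecD p 2

theorem ratioA_pos (p : Param 2) : 0 < ratioA p := div_pos (vecD_pos p 0) (vecD_pos p 1)

theorem ratioB_pos (p : Param 2) : 0 < ratioB p :=
  div_pos (mul_pos four_pos (vecD_pos p 1)) (vecD_pos p 2)

/-- The eigenvalues of the curvature at the origin. -/
def curvEigenvalue (p : Param 2) : Fin 3 → ℝ :=
  ![2 * p.lam - 2 - ratioA p, 2 * p.lam + ratioA p - ratioB p, 2 * p.lam + 2 + ratioB p]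

theorem curv_zero (p : Param 2) :
    curv p 0 = Matrix.diagonal fun i => (curvEigenvalue p i : ℂ) := by
  have h := (curvature_zero_of_polarization
    (analyticAt_polarMetric (-2 * (p.lam : ℂ) - 2) (sqrtD p))
    (polarMetric_zero _ (sqrtD_ne_zero p))
    (fun i j w => hasDerivAt_polarMetric _ (sqrtD_ne_zero p) w i j)).1
  rw [curv, metric_eq_polarMetric, h]
  ext i j
  fin_cases i <;> fin_cases j <;>
    simp [polarDeriv, curvEigenvalue, sqrtD_sq, ratioA, ratioB] <;> ring

theorem curvBar_zero (p : Param 2) :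
    curvBar p 0 =
      !![0, 2 * (sqrtD p 0 / sqrtD p 1) * (-1 - ratioA p + ratioB p / 2), 0;
        0, 0, 2 * (sqrtD p 1 / sqrtD p 2) * (-2 + ratioA p - 2 * ratioB p);
        0, 0, 0] := by
  have h := (curvature_zero_of_polarization
    (analyticAt_polarMetric (-2 * (p.lam : ℂ) - 2) (sqrtD p))
    (polarMetric_zero _ (sqrtD_ne_zero p))
    (fun i j w => hasDerivAt_polarMetric _ (sqrtD_ne_zero p) w i j)).2
  unfold curvBar
  rw [show curv p = curvature (metric p) from rfl, metric_eq_polarMetric, h]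
  ext i j
  fin_cases i <;> fin_cases j <;>
    simp [polarDeriv, sqrtD_sq, ratioA, ratioB] <;> ring

/-! ### Intertwiners -/

theorem UnitarilyEquivalent.refl {H : Type*} [NormedAddCommGroup H] [InnerProductSpace ℂ H]
    (A : H →ₗ.[ℂ] H) : UnitarilyEquivalent A A :=
  ⟨LinearIsometryEquiv.refl ℂ H, fun _ => Iff.rfl, fun f g h => by
    rw [Subtype.ext (h : (g : H) = f)]; rfl⟩

/-- Diagonal matrices intertwined by an invertible matrix have the same characteristic
polynomial. -/
theorem prod_sub_eq_of_intertwine {n : ℕ} {L : Matrix (Fin n) (Fin n) ℂ} (hL : IsUnit L)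
    {x y : Fin n → ℝ}
    (h : L * Matrix.diagonal (fun i => (x i : ℂ)) = Matrix.diagonal (fun i => (y i : ℂ)) * L)
    (t : ℝ) : ∏ i, (t - x i) = ∏ i, (t - y i) := by
  have hdiag (v : Fin n → ℝ) : Matrix.diagonal (fun i => ((t - v i : ℝ) : ℂ)) =
      (t : ℂ) • 1 - Matrix.diagonal fun i => (v i : ℂ) := by
    rw [← Matrix.diagonal_one, ← Matrix.diagonal_smul, Matrix.diagonal_sub]
    congr 1
    ext i
    simp
  have h2 : L * Matrix.diagonal (fun i => ((t - x i : ℝ) : ℂ)) =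
      Matrix.diagonal (fun i => ((t - y i : ℝ) : ℂ)) * L := by
    rw [hdiag, hdiag, mul_sub, sub_mul, h]
    simp
  have h3 := congrArg Matrix.det h2
  rw [Matrix.det_mul, Matrix.det_mul, mul_comm, Matrix.det_diagonal, Matrix.det_diagonal] at h3
  have h4 := mul_right_cancel₀ ((Matrix.isUnit_iff_isUnit_det L).mp hL).ne_zero h3
  exact_mod_cast h4

theorem apply_eq_zero_of_intertwine {n : ℕ} {L : Matrix (Fin n) (Fin n) ℂ} {x y : Fin n → ℝ}
    (h : L * Matrix.diagonal (fun i => (x i : ℂ)) = Matrix.diagonal (fun i => (y i : ℂ)) * L)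
    {i j : Fin n} (hij : x j ≠ y i) : L i j = 0 := by
  have h1 := congrFun (congrFun h i) j
  rw [Matrix.mul_diagonal, Matrix.diagonal_mul] at h1
  have h2 : ((x j - y i : ℝ) : ℂ) ≠ 0 := by exact_mod_cast sub_ne_zero.mpr hij
  refine (mul_eq_zero.mp (?_ : L i j * ((x j - y i : ℝ) : ℂ) = 0)).resolve_right h2
  push_cast
  linear_combination h1

/-- An invertible matrix supported on `(0, 0)`, `(1, 2)`, `(2, 1)` cannot carry a non-zero weighted
shift to another one. -/
theorem shift_eq_zero_of_swap_one_two {L : Matrix (Fin 3) (Fin 3) ℂ} (hL : IsUnit L)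
    (h01 : L 0 1 = 0) (h02 : L 0 2 = 0) (h10 : L 1 0 = 0) (h11 : L 1 1 = 0) (h20 : L 2 0 = 0)
    (h22 : L 2 2 = 0) {a b c d : ℂ}
    (h : L * !![0, a, 0; 0, 0, b; 0, 0, 0] = !![0, c, 0; 0, 0, d; 0, 0, 0] * L) :
    a = 0 ∧ b = 0 := by
  have hdet := ((Matrix.isUnit_iff_isUnit_det L).mp hL).ne_zero
  rw [Matrix.det_fin_three] at hdet
  simp only [h01, h02, h10, h11, h20, h22] at hdet
  have n00 : L 0 0 ≠ 0 := fun h => hdet (by rw [h]; ring)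
  have n12 : L 1 2 ≠ 0 := fun h => hdet (by rw [h]; ring)
  have n21 : L 2 1 ≠ 0 := fun h => hdet (by rw [h]; ring)
  have e01 := congrFun (congrFun h 0) 1
  have e22 := congrFun (congrFun h 2) 2
  simp [Matrix.mul_apply, Fin.sum_univ_three, h11, n00] at e01
  simp [Matrix.mul_apply, Fin.sum_univ_three, n21] at e22
  exact ⟨e01, e22⟩

/-- An invertible matrix supported on `(0, 1)`, `(1, 0)`, `(2, 2)` cannot carry a non-zero weighted
shift to another one. -/
theorem shift_eq_zero_of_swap_zero_one {L : Matrix (Fin 3) (Fin 3) ℂ} (hL : IsUnit L)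
    (h00 : L 0 0 = 0) (h02 : L 0 2 = 0) (h11 : L 1 1 = 0) (h12 : L 1 2 = 0) (h20 : L 2 0 = 0)
    (h21 : L 2 1 = 0) {a b c d : ℂ}
    (h : L * !![0, a, 0; 0, 0, b; 0, 0, 0] = !![0, c, 0; 0, 0, d; 0, 0, 0] * L) :
    a = 0 ∧ b = 0 := by
  have hdet := ((Matrix.isUnit_iff_isUnit_det L).mp hL).ne_zero
  rw [Matrix.det_fin_three] at hdet
  simp only [h00, h02, h11, h12, h20, h21] at hdet
  have n01 : L 0 1 ≠ 0 := fun h => hdet (by rw [h]; ring)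
  have n10 : L 1 0 ≠ 0 := fun h => hdet (by rw [h]; ring)
  have e11 := congrFun (congrFun h 1) 1
  have e02 := congrFun (congrFun h 0) 2
  simp [Matrix.mul_apply, Fin.sum_univ_three, h21, n10] at e11
  simp [Matrix.mul_apply, Fin.sum_univ_three, h12, n01] at e02
  exact ⟨e11, e02⟩

/-- The two weights of `𝒦_{z̄}(0)` do not vanish together: that would give `b = 2 + 2 a` and
`a = 2 + 2 b` for the positive numbers `a = d₀ / d₁` and `b = 4 d₁ / d₂`. -/
theorem not_weights_eq_zero (p : Param 2) :
    ¬ (2 * (sqrtD p 0 / sqrtD p 1) * (-1 - ratioA p + ratioB p / 2) = 0 ∧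
      2 * (sqrtD p 1 / sqrtD p 2) * (-2 + ratioA p - 2 * ratioB p) = 0) := by
  have n0 := sqrtD_ne_zero p 0
  have n1 := sqrtD_ne_zero p 1
  have n2 := sqrtD_ne_zero p 2
  simp only [mul_eq_zero, div_eq_zero_iff, n0, n1, n2, OfNat.ofNat_ne_zero, false_or]
  rintro ⟨h1, h2⟩
  have h1' : -1 - ratioA p + ratioB p / 2 = 0 := by exact_mod_cast h1
  have h2' : -2 + ratioA p - 2 * ratioB p = 0 := by exact_mod_cast h2
  have := ratioA_pos p
  linarith

theorem Param.eq_of_ratio {p q : Param 2} (hl : p.lam = q.lam) (ha : ratioA p = ratioA q)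
    (hb : ratioB p = ratioB q) : p = q := by
  have h0 : vecD p 0 = vecD q 0 := (vecD_two_apply p).1.trans (vecD_two_apply q).1.symm
  have h1 : vecD p 1 = vecD q 1 := by
    rw [ratioA, ratioA, h0] at ha
    rw [div_eq_div_iff (vecD_pos p 1).ne' (vecD_pos q 1).ne'] at ha
    exact (mul_left_cancel₀ (vecD_pos q 0).ne' ha).symm
  have h2 : vecD p 2 = vecD q 2 := by
    rw [ratioB, ratioB, h1] at hb
    rw [div_eq_div_iff (vecD_pos p 2).ne' (vecD_pos q 2).ne'] at hb
    exact (mul_left_cancel₀ (mul_pos four_pos (vecD_pos q 1)).ne' hb).symm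
  refine Param.eq_of_vecD hl fun i => ?_
  fin_cases i
  exacts [h0, h1, h2]

/-- If the curvatures at the origin have the same spectrum, then either the parameters agree or the
middle eigenvalue has changed places with one of the outer ones. Indeed the trace gives `λ`, and
the first and the last eigenvalue lie below `2 λ - 2` and above `2 λ + 2`. -/
theorem curvEigenvalue_cases {p q : Param 2}
    (h : ∀ t, ∏ i, (t - curvEigenvalue p i) = ∏ i, (t - curvEigenvalue q i)) :
    p = q ∨ p.lam = q.lam ∧ ((ratioA q = ratioA p ∧ ratioB q = ratioA p - ratioB p - 2) ∨
      (ratioB q = ratioB p ∧ ratioA q = ratioB p - ratioA p - 2)) := by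
  have a0 := ratioA_pos p
  have b0 := ratioB_pos p
  have a1 := ratioA_pos q
  have b1 := ratioB_pos q
  have hl : p.lam = q.lam := by
    have e0 := h 0
    have e1 := h 1
    have e2 := h (-1)
    simp only [Fin.prod_univ_three, curvEigenvalue, Matrix.cons_val] at e0 e1 e2
    linarith
  rcases eq_or_ne p q with rfl | hpq
  · exact Or.inl rfl
  refine Or.inr (And.intro hl ?_)
  have f0 := h (curvEigenvalue q 0)
  have f2 := h (curvEigenvalue q 2)
  simp only [Fin.prod_univ_three, curvEigenvalue, Matrix.cons_val, sub_self, zero_mul, mul_zero,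
    mul_eq_zero, hl] at f0 f2
  rcases f0 with (f0 | f0) | f0
  · rcases f2 with (f2 | f2) | f2
    · linarith
    · left
      constructor <;> linarith
    · exact absurd (Param.eq_of_ratio hl (by linarith) (by linarith)) hpq
  · rcases f2 with (f2 | f2) | f2
    · linarith
    · linarith
    · right
      constructor <;> linarith
  · linarith

end KM

end

theorem mainTheorem4 (p q : KM.Param 2)
    (hne : ¬ KM.UnitarilyEquivalent (KM.mulOp (KM.Space p)) (KM.mulOp (KM.Space q)))
    (hcurv : ∀ z : ℂ, ‖z‖ < 1 → KM.CurvEquivAt p q z) :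
    ¬ ∃ L : Matrix (Fin 3) (Fin 3) ℂ, IsUnit L ∧
      L * KM.curv p 0 = KM.curv q 0 * L ∧
      L * KM.curvBar p 0 = KM.curvBar q 0 * L := by
  open KM in
  rintro ⟨L, hL, h1, h2⟩
  rw [curv_zero, curv_zero] at h1
  rw [curvBar_zero, curvBar_zero] at h2
  have hpq : p ≠ q := by
    rintro rfl
    exact hne (UnitarilyEquivalent.refl _)
  have a0 := ratioA_pos p
  have b0 := ratioB_pos p
  have a1 := ratioA_pos q
  have b1 := ratioB_pos q
  have hz {i j : Fin 3} : curvEigenvalue p j ≠ curvEigenvalue q i → L i j = 0 :=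
    apply_eq_zero_of_intertwine h1
  rcases curvEigenvalue_cases (prod_sub_eq_of_intertwine hL h1) with h | ⟨hl, ⟨ha, hb⟩ | ⟨hb, ha⟩⟩
  · exact hpq h
  · -- The eigenvalues `1` and `2` are interchanged, and they differ since `p ≠ q`.
    have hab : ratioB q ≠ ratioB p := fun h => hpq (Param.eq_of_ratio hl ha.symm h.symm)
    refine not_weights_eq_zero p (shift_eq_zero_of_swap_one_two hL (hz ?_) (hz ?_) (hz ?_) (hz ?_)
      (hz ?_) (hz ?_) h2) <;>
      simp only [curvEigenvalue, Matrix.cons_val] <;> intro h <;>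
      first | linarith | exact hab (by linarith)
  · -- The eigenvalues `0` and `1` are interchanged, and they differ since `p ≠ q`.
    have hab : ratioA q ≠ ratioA p := fun h => hpq (Param.eq_of_ratio hl h.symm hb.symm)
    refine not_weights_eq_zero p (shift_eq_zero_of_swap_zero_one hL (hz ?_) (hz ?_) (hz ?_) (hz ?_)
      (hz ?_) (hz ?_) h2) <;>
      simp only [curvEigenvalue, Matrix.cons_val] <;> intro h <;>
      first | linarith | exact hab (by linarith)
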